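/- Let $L$ be an oriented virtual link with $\mu$ components $K_1,\dots,K_\mu$, let $D$ be a diagram of $L$, let $A(D)$ be its set of arcs (the components are cut at the underpasses of classical crossings only) and $C(D)$ its set of classical crossings. For $c\in C(D)$ let $a(c)$ be the overpassing arc, and let $b_1(c)$ and $b_2(c)$ be the underpassing arcs on the right and on the left side of $a(c)$, respectively. A quandle is a set with a binary operation $\triangleright$ such that $x\triangleright x=x$ for all $x$, each map $\beta_y\colon x\mapsto x\triangleright y$ is a bijection, and $(w\triangleright x)\triangleright y=(w\triangleright y)\triangleright(x\triangleright y)$ for all $w,x,y$. It is medial if $(w\triangleright x)\triangleright(y\triangleright z)=(w\triangleright y)\triangleright(x\triangleright z)$ for all $w,x,y,z$. Let $\mathrm{MQ}(L)$ be the medial quandle generated by elements $q_a$, $a\in A(D)$, with the relations $q_{b_2(c)}=q_{b_1(c)}\triangleright q_{a(c)}$ for $c\in C(D)$, and let $\mathrm{IMQ}(L)$ be its involutory quotient, i.e. the quandle with a generator $x_{\mathrm{inv}}$ for each $x\in\mathrm{MQ}(L)$ and the relations $x_{\mathrm{inv}}\triangleright y_{\mathrm{inv}}=(x\triangleright y)_{\mathrm{inv}}$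 and $((x\triangleright y)\triangleright y)_{\mathrm{inv}}=x_{\mathrm{inv}}$ for all $x,y\in \mathrm{MQ}(L)$. Let $\Lambda=\mathbb Z[t,t^{-1}]$. The reduced Alexander module $M_A^{\mathrm{red}}(L)$ is the $\Lambda$-module generated by $A(D)$ with the relations $(1-t)a(c)+t\,b_1(c)-b_2(c)=0$ for $c\in C(D)$, and $\phi_L^{\mathrm{red}}\colon M_A^{\mathrm{red}}(L)\to\Lambda$ is the $\Lambda$-linear map that sends every arc to $1$. If $\ker\phi_L^{\mathrm{red}}/(1+t)\ker\phi_L^{\mathrm{red}}$ is finite, then $\mathrm{IMQ}(L)$ is finite and $$\frac{\mu\,|\ker\phi_L^{\mathrm{red}}/(1+t)\ker\phi_L^{\mathrm{red}}|}{2}\;\le\;|\mathrm{IMQ}(L)|\;\le\;\mu\,|\ker\phi_L^{\mathrm{red}}/(1+t)\ker\phi_L^{\mathrm{red}}|.$$ In the special case $\mu=1$, $|\mathrm{IMQ}(L)|=|\ker\phi_L^{\mathrm{red}}/(1+t)\ker\phi_L^{\mathrm{red}}|$. -/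

import Mathlib

open scoped LaurentPolynomial Quandles

/-! ### Quandles given by generators and relations

Mathlib writes `y ◃ x` for the image of `x` under the translation (inner automorphism) of `y`.
So the operation `x ▹ y = β_y(x)` is `y ◃ x` below, and `x ▹⁻¹ y` is `y ◃⁻¹ x`. -/

/-- Formal quandle words in a set `X` of generators. -/
inductive QuandleWord (X : Type) : Type
  | of (x : X) : QuandleWord X
  | act (y x : QuandleWord X) : QuandleWord X
  | invAct (y x : QuandleWord X) : QuandleWord X

/-- The smallest congruence on quandle words that contains the relations `R` and enforces the
quandle axioms. -/
inductive QuandleCongr {X : Type} (R : QuandleWord X → QuandleWord X → Prop) :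
    QuandleWord X → QuandleWord X → Prop
  | rel {x y} : R x y → QuandleCongr R x y
  | refl (x) : QuandleCongr R x x
  | symm {x y} : QuandleCongr R x y → QuandleCongr R y x
  | trans {x y z} : QuandleCongr R x y → QuandleCongr R y z → QuandleCongr R x z
  | act_congr {x x' y y'} : QuandleCongr R y y' → QuandleCongr R x x' →
      QuandleCongr R (.act y x) (.act y' x')
  | invAct_congr {x x' y y'} : QuandleCongr R y y' → QuandleCongr R x x' →
      QuandleCongr R (.invAct y x) (.invAct y' x')
  | invAct_act (y x) : QuandleCongr R (.invAct y (.act y x)) x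
  | act_invAct (y x) : QuandleCongr R (.act y (.invAct y x)) x
  | self_distrib (x y z) :
      QuandleCongr R (.act x (.act y z)) (.act (.act x y) (.act x z))
  | fix (x) : QuandleCongr R (.act x x) x

/-- The congruence `QuandleCongr R` as a setoid. -/
def quandleSetoid {X : Type} (R : QuandleWord X → QuandleWord X → Prop) :
    Setoid (QuandleWord X) where
  r := QuandleCongr R
  iseqv := ⟨.refl, .symm, .trans⟩

/-- The quandle presented by the generators `X` and the relations `R`. -/
def PresentedQuandle {X : Type} (R : QuandleWord X → QuandleWord X → Prop) : Type :=
  Quotient (quandleSetoid R)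

instance {X : Type} (R : QuandleWord X → QuandleWord X → Prop) :
    Quandle (PresentedQuandle R) where
  act := Quotient.map₂ QuandleWord.act fun _ _ h _ _ h' => QuandleCongr.act_congr h h'
  invAct := Quotient.map₂ QuandleWord.invAct fun _ _ h _ _ h' => QuandleCongr.invAct_congr h h'
  self_distrib := by
    rintro ⟨x⟩ ⟨y⟩ ⟨z⟩
    exact Quotient.sound (QuandleCongr.self_distrib x y z)
  left_inv := by
    rintro ⟨y⟩ ⟨x⟩
    exact Quotient.sound (QuandleCongr.invAct_act y x)
  right_inv := by
    rintro ⟨y⟩ ⟨x⟩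
    exact Quotient.sound (QuandleCongr.act_invAct y x)
  fix := by
    rintro ⟨x⟩
    exact Quotient.sound (QuandleCongr.fix x)

/-- The relations `R` together with all instances of the medial law
`(w ▹ x) ▹ (y ▹ z) = (w ▹ y) ▹ (x ▹ z)`. -/
inductive MedialRel {X : Type} (R : QuandleWord X → QuandleWord X → Prop) :
    QuandleWord X → QuandleWord X → Prop
  | rel {x y} : R x y → MedialRel R x y
  | medial (w x y z) :
      MedialRel R (.act (.act z y) (.act x w)) (.act (.act z x) (.act y w))

/-- The medial quandle presented by the generators `X` and the relations `R`. -/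
abbrev PresentedMedialQuandle {X : Type} (R : QuandleWord X → QuandleWord X → Prop) : Type :=
  PresentedQuandle (MedialRel R)

/-- The defining relations of the involutory quotient of a quandle `Q`:
`x_inv ▹ y_inv = (x ▹ y)_inv` and `((x ▹ y) ▹ y)_inv = x_inv`. -/
inductive InvolutoryRel (Q : Type) [Quandle Q] : QuandleWord Q → QuandleWord Q → Prop
  | act (x y : Q) : InvolutoryRel Q (.act (.of y) (.of x)) (.of (y ◃ x))
  | invol (x y : Q) : InvolutoryRel Q (.of (y ◃ y ◃ x)) (.of x)

/-- The involutory quotient `Q_inv` of a quandle `Q`. -/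
abbrev InvolutoryQuotient (Q : Type) [Quandle Q] : Type :=
  PresentedQuandle (InvolutoryRel Q)

/-! ### Virtual link diagrams -/

/-- The two ways in which a strand can pass through a classical crossing. -/
inductive Level : Type
  | over
  | under

/-- A diagram of an oriented virtual link with `μ` components (indexed by `Fin μ`), given by its
Gauss diagram. There are `μ` oriented closed curves. Each classical crossing is passed twice, once
on the overpassing and once on the underpassing strand; `(c, .over)` and `(c, .under)` are these
two passages. `comp p` is the curve on which the passage `p` lies, and `next p` is the passage that
follows `p` when one walks along that curve in the direction of its orientation. Curves without
classical crossings are allowed. Virtual crossings are not recorded. -/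
structure VirtualLinkDiagram (μ : ℕ) where
  /-- The set `C(D)` of classical crossings. -/
  Crossing : Type
  finite_crossing : Finite Crossing
  /-- The writhe of a crossing, `1` or `-1`. -/
  writhe : Crossing → ℤˣ
  comp : Crossing × Level → Fin μ
  next : Equiv.Perm (Crossing × Level)
  /-- The passages on any one curve are visited in one cycle. -/
  comp_eq_iff : ∀ p q, comp p = comp q ↔ next.SameCycle p q

namespace VirtualLinkDiagram

variable {μ : ℕ} (D : VirtualLinkDiagram μ)

/-- The pieces into which the curves are cut at all passages (over and under): `.inl p` is the piece
that leads from `p` to `D.next p`, and `.inr i` is the whole `i`th curve, if it has no passages. -/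
abbrev Segment : Type :=
  (D.Crossing × Level) ⊕ {i : Fin μ // ∀ p, D.comp p ≠ i}

/-- The pieces before and after an overpassage belong to the same arc. -/
inductive Joined : D.Segment → D.Segment → Prop
  | over (p : D.Crossing × Level) (h : (D.next p).2 = .over) :
      Joined (.inl p) (.inl (D.next p))

/-- The set `A(D)` of (long) arcs: the curves are cut at the underpassages only. -/
def Arc : Type := Quot D.Joined

/-- The overpassing arc `a(c)`. -/
def overArc (c : D.Crossing) : D.Arc := Quot.mk _ (.inl (c, .over))

/-- The underpassing arc that ends at `c`. -/
def inArc (c : D.Crossing) : D.Arc := Quot.mk _ (.inl (D.next.symm (c, .under)))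

/-- The underpassing arc that starts at `c`. -/
def outArc (c : D.Crossing) : D.Arc := Quot.mk _ (.inl (c, .under))

/-- The underpassing arc `b₁(c)` on the right side of the overpassing arc. At a crossing of
writhe `1`, the underpassing strand goes from right to left. -/
def rightArc (c : D.Crossing) : D.Arc := if D.writhe c = 1 then D.inArc c else D.outArc c

/-- The underpassing arc `b₂(c)` on the left side of the overpassing arc. -/
def leftArc (c : D.Crossing) : D.Arc := if D.writhe c = 1 then D.outArc c else D.inArc c

/-! ### The medial quandle and the involutory medial quandle -/

/-- The crossing relations `q_{b₂(c)} = q_{b₁(c)} ▹ q_{a(c)}`. -/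
inductive CrossingRel : QuandleWord D.Arc → QuandleWord D.Arc → Prop
  | crossing (c : D.Crossing) :
      CrossingRel (.of (D.leftArc c)) (.act (.of (D.overArc c)) (.of (D.rightArc c)))

/-- The medial quandle `MQ(L)`. -/
abbrev MQ : Type := PresentedMedialQuandle D.CrossingRel

/-- The involutory medial quandle `IMQ(L)`, the involutory quotient of `MQ(L)`. -/
abbrev IMQ : Type := InvolutoryQuotient D.MQ

/-! ### The reduced Alexander module, over `Λ = ℤ[T;T⁻¹]` with `t = LaurentPolynomial.T 1` -/

/-- The map `Λ^C(D) → Λ^A(D)`, `c ↦ (1 - t) a(c) + t b₁(c) - b₂(c)`. -/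
noncomputable def rho : (D.Crossing →₀ ℤ[T;T⁻¹]) →ₗ[ℤ[T;T⁻¹]] (D.Arc →₀ ℤ[T;T⁻¹]) :=
  Finsupp.linearCombination ℤ[T;T⁻¹] fun c =>
    Finsupp.single (D.overArc c) (1 - LaurentPolynomial.T 1)
      + Finsupp.single (D.rightArc c) (LaurentPolynomial.T 1) - Finsupp.single (D.leftArc c) 1

/-- The reduced Alexander module, the cokernel of `rho`. -/
abbrev AlexanderModule : Type := (D.Arc →₀ ℤ[T;T⁻¹]) ⧸ LinearMap.range D.rho

/-- The map `φ_L^red` from the reduced Alexander module to `Λ` that sends every arc to `1`. -/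
noncomputable def phi : D.AlexanderModule →ₗ[ℤ[T;T⁻¹]] ℤ[T;T⁻¹] :=
  (LinearMap.range D.rho).liftQ (Finsupp.linearCombination ℤ[T;T⁻¹] fun _ => 1) <| by
    rw [LinearMap.range_le_ker_iff]
    ext c
    simp [rho]

/-- The quotient `ker φ_L^red / (1 + t) ker φ_L^red`. -/
abbrev AlexanderInvariantQuotient : Type :=
  QuotSMulTop (1 + LaurentPolynomial.T 1 : ℤ[T;T⁻¹]) (LinearMap.ker D.phi)

end VirtualLinkDiagram

/-! Let `K` be the Alexander quotient. There `t` acts as `-1`, so `K` is the abelian group generated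
by the differences `pos x` of arcs `x` from a reference arc `a₀`, with the relations `b₁ + b₂ = 2a`
at the crossings. The cardinality of `IMQ(L)` is trapped by surjections `Fin μ × K → IMQ(L)` and
`IMQ(L) → Σ i, K/⟨h i⟩`, where `2 h i = 0`.

Upper bound (`exists_surjective_to_IMQ`): translations `β` of an involutory medial quandle are
involutions whose pairwise products commute. The displacements `β_x β_{a₀}` satisfy the relations of
`K`, so `K` acts on `IMQ(L)` (`exists_displacement`), and the orbits of one arc per component cover
everything.

Lower bound (`exists_surjective_from_IMQ`): on component `i`, with base arc `e`, each arc `x` is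
coloured by some `v` with `pos e + 2v = pos x`. Walking once around the component may change `v` by
an element `h i` of order at most two (`exists_halves`), so the colours are taken modulo `h i`. They
surject onto the mesh.

For `μ = 1` every `pos x` is a double, so doubling is onto the finitely generated group `K`, hence
injective. Thus `h = 0` and both bounds agree (`eq_zero_of_add_self`). -/

/-! ### Homomorphisms from presented quandles -/

/-- The value of a quandle word under an assignment of its generators. -/
def QuandleWord.eval {X Q : Type} [Quandle Q] (f : X → Q) : QuandleWord X → Q
  | .of x => f x
  | .act y x => y.eval f ◃ x.eval f
  | .invAct y x => y.eval f ◃⁻¹ x.eval f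

theorem QuandleCongr.eval_eq {X Q : Type} [Quandle Q] {R : QuandleWord X → QuandleWord X → Prop}
    (f : X → Q) (hf : ∀ x y, R x y → x.eval f = y.eval f) {x y : QuandleWord X}
    (h : QuandleCongr R x y) : x.eval f = y.eval f := by
  induction h with
  | rel h => exact hf _ _ h
  | refl => rfl
  | symm _ ih => exact ih.symm
  | trans _ _ ih ih' => exact ih.trans ih'
  | act_congr _ _ ih ih' => simp only [QuandleWord.eval, ih, ih']
  | invAct_congr _ _ ih ih' => simp only [QuandleWord.eval, ih, ih']
  | invAct_act y x => exact Rack.left_inv _ _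
  | act_invAct y x => exact Rack.right_inv _ _
  | self_distrib x y z => exact Shelf.self_distrib
  | fix x => exact Quandle.fix

namespace PresentedQuandle

variable {X : Type} {R : QuandleWord X → QuandleWord X → Prop}

/-- The element of a presented quandle represented by a word. -/
def mk (R : QuandleWord X → QuandleWord X → Prop) (w : QuandleWord X) : PresentedQuandle R :=
  Quotient.mk _ w

theorem mk_act (y x : QuandleWord X) : mk R (.act y x) = mk R y ◃ mk R x := rfl

theorem mk_invAct (y x : QuandleWord X) : mk R (.invAct y x) = mk R y ◃⁻¹ mk R x := rfl

theorem mk_surjective : Function.Surjective (mk R) := Quotient.mk_surjective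

theorem mk_eq {x y : QuandleWord X} (h : R x y) : mk R x = mk R y := Quotient.sound (.rel h)

/-- The homomorphism given by images of the generators that satisfy the relations. -/
def lift {Q : Type} [Quandle Q] (f : X → Q) (hf : ∀ x y, R x y → x.eval f = y.eval f) :
    PresentedQuandle R →◃ Q where
  toFun := Quotient.lift (QuandleWord.eval f) fun _ _ h => QuandleCongr.eval_eq f hf h
  map_act' := by
    rintro ⟨x⟩ ⟨y⟩
    rfl

end PresentedQuandle

/-! ### Involutory medial quandles and their translations -/

/-- A quandle with `(w ▹ x) ▹ (y ▹ z) = (w ▹ y) ▹ (x ▹ z)` and `(x ▹ y) ▹ y = x`. -/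
structure IsInvolutoryMedial (Q : Type) [Quandle Q] : Prop where
  medial : ∀ w x y z : Q, (z ◃ y) ◃ x ◃ w = (z ◃ x) ◃ y ◃ w
  invol : ∀ x y : Q, y ◃ y ◃ x = x

theorem PresentedMedialQuandle.medial {X : Type} {R : QuandleWord X → QuandleWord X → Prop}
    (w x y z : PresentedMedialQuandle R) : (z ◃ y) ◃ x ◃ w = (z ◃ x) ◃ y ◃ w := by
  obtain ⟨w, rfl⟩ := PresentedQuandle.mk_surjective w
  obtain ⟨x, rfl⟩ := PresentedQuandle.mk_surjective x
  obtain ⟨y, rfl⟩ := PresentedQuandle.mk_surjective y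
  obtain ⟨z, rfl⟩ := PresentedQuandle.mk_surjective z
  exact PresentedQuandle.mk_eq (MedialRel.medial w x y z)

namespace InvolutoryQuotient

variable {Q : Type} [Quandle Q]

/-- The canonical map from a quandle to its involutory quotient. -/
def of (x : Q) : InvolutoryQuotient Q := PresentedQuandle.mk _ (.of x)

theorem of_act (y x : Q) : of (y ◃ x) = of y ◃ of x :=
  (PresentedQuandle.mk_eq (InvolutoryRel.act x y)).symm

theorem of_act_act (y x : Q) : of (y ◃ y ◃ x) = of x :=
  PresentedQuandle.mk_eq (InvolutoryRel.invol x y)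

theorem of_invAct (y x : Q) : of (y ◃⁻¹ x) = of y ◃⁻¹ of x := by
  rw [← Rack.left_cancel (of y), ← of_act, Rack.act_invAct_eq, Rack.act_invAct_eq]

/-- The defining relations make the image of `of` closed under both operations, and it contains the
generators. -/
theorem of_surjective : Function.Surjective (of : Q → InvolutoryQuotient Q) := by
  intro z
  obtain ⟨w, rfl⟩ := PresentedQuandle.mk_surjective z
  induction w with
  | of x => exact ⟨x, rfl⟩
  | act y x ihy ihx =>
    obtain ⟨y', hy⟩ := ihy
    obtain ⟨x', hx⟩ := ihx
    exact ⟨y' ◃ x', by rw [of_act, hy, hx, PresentedQuandle.mk_act]⟩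
  | invAct y x ihy ihx =>
    obtain ⟨y', hy⟩ := ihy
    obtain ⟨x', hx⟩ := ihx
    exact ⟨y' ◃⁻¹ x', by rw [of_invAct, hy, hx, PresentedQuandle.mk_invAct]⟩

theorem isInvolutoryMedial (hQ : ∀ w x y z : Q, (z ◃ y) ◃ x ◃ w = (z ◃ x) ◃ y ◃ w) :
    IsInvolutoryMedial (InvolutoryQuotient Q) where
  medial w x y z := by
    obtain ⟨w, rfl⟩ := of_surjective w
    obtain ⟨x, rfl⟩ := of_surjective x
    obtain ⟨y, rfl⟩ := of_surjective y
    obtain ⟨z, rfl⟩ := of_surjective z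
    simp only [← of_act, hQ w x y z]
  invol x y := by
    obtain ⟨x, rfl⟩ := of_surjective x
    obtain ⟨y, rfl⟩ := of_surjective y
    rw [← of_act, ← of_act, of_act_act]

end InvolutoryQuotient

namespace IsInvolutoryMedial

variable {Q : Type} [Quandle Q] (hQ : IsInvolutoryMedial Q)
include hQ

theorem act'_mul_self (x : Q) : Rack.act' x * Rack.act' x = 1 :=
  Equiv.ext fun y => hQ.invol y x

theorem act'_inv (x : Q) : (Rack.act' x)⁻¹ = Rack.act' x :=
  inv_eq_of_mul_eq_one_right (hQ.act'_mul_self x)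

theorem invAct_eq (x y : Q) : x ◃⁻¹ y = x ◃ y := by
  rw [← Rack.left_cancel x, Rack.act_invAct_eq, hQ.invol]

theorem act'_act (x y : Q) :
    Rack.act' (x ◃ y) = Rack.act' x * Rack.act' y * Rack.act' x := by
  rw [Rack.ad_conj, hQ.act'_inv]

/-- This is the medial law read as an identity of permutations, with a common factor `β_z` cancelled
on the left. -/
theorem act'_mul_act'_mul_act' (x y z : Q) :
    Rack.act' x * Rack.act' z * Rack.act' y = Rack.act' y * Rack.act' z * Rack.act' x := by
  have h : Rack.act' (z ◃ y) * Rack.act' x = Rack.act' (z ◃ x) * Rack.act' y :=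
    Equiv.ext fun w => hQ.medial w x y z
  rw [hQ.act'_act, hQ.act'_act] at h
  simpa only [mul_assoc, mul_right_inj] using h.symm

/-- Source of the abelian displacement group. -/
theorem commute_act'_mul (x y z : Q) :
    Commute (Rack.act' x * Rack.act' z) (Rack.act' y * Rack.act' z) := by
  rw [Commute, SemiconjBy, ← mul_assoc, hQ.act'_mul_act'_mul_act', mul_assoc]

end IsInvolutoryMedial

instance : Finite Level :=
  Finite.of_surjective (fun b : Bool => if b then Level.over else Level.under) fun l => by
    cases l
    exacts [⟨true, rfl⟩, ⟨false, rfl⟩]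

/-- Unrolling a cycle: values can be propagated along the orbit of `x₀`, except that the value
obtained on the return to `x₀` need not be the initial value. -/
theorem Equiv.Perm.exists_propagate {X Z : Type*} (σ : Equiv.Perm X) (step : X → Z → Z) (x₀ : X)
    (z₀ : Z) (P : X → Z → Prop) (h₀ : P x₀ z₀)
    (hP : ∀ x z, P x z → P (σ x) (step (σ x) z)) :
    ∃ v : X → Z, v x₀ = z₀ ∧ ∀ x, (∃ n : ℕ, (σ ^ n) x₀ = x) →
      P x (v x) ∧ (σ x ≠ x₀ → v (σ x) = step (σ x) (v x)) := by
  classical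
  let w : ℕ → Z := Nat.rec z₀ fun n z => step ((σ ^ (n + 1)) x₀) z
  have hw : ∀ n, P ((σ ^ n) x₀) (w n) := by
    intro n
    induction n with
    | zero => exact h₀
    | succ n ih =>
      have := hP _ _ ih
      rwa [← Equiv.Perm.mul_apply, ← pow_succ'] at this
  -- The value at the first visit; the default off the orbit is irrelevant.
  let v : X → Z := fun x => if h : ∃ n : ℕ, (σ ^ n) x₀ = x then w (Nat.find h) else z₀
  have hv : ∀ x n, (σ ^ n) x₀ = x → (∀ m < n, (σ ^ m) x₀ ≠ x) → v x = w n := by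
    intro x n hn hm
    have h : ∃ n : ℕ, (σ ^ n) x₀ = x := ⟨n, hn⟩
    have : Nat.find h = n := (Nat.find_eq_iff h).2 ⟨hn, hm⟩
    simp only [v, dif_pos h, this]
  refine ⟨v, hv x₀ 0 rfl (by simp), fun x hx => ?_⟩
  have hn := Nat.find_spec hx
  have hm := fun m => Nat.find_min hx (m := m)
  generalize Nat.find hx = n at hn hm
  rw [hv x n hn hm]
  refine ⟨hn ▸ hw n, fun hne => ?_⟩
  have hs : (σ ^ (n + 1)) x₀ = σ x := by rw [pow_succ', Equiv.Perm.mul_apply, hn]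
  rw [hv (σ x) (n + 1) hs ?_]
  · exact congrArg (fun y => step y (w n)) hs
  · rintro (_ | m) hlt heq
    · exact hne heq.symm
    · rw [pow_succ', Equiv.Perm.mul_apply] at heq
      exact hm m (by omega) (σ.injective heq)

namespace VirtualLinkDiagram

variable {μ : ℕ} (D : VirtualLinkDiagram μ)

/-! ### Walking along the components -/

/-- The segment that follows a given segment. -/
def nextSegment : Equiv.Perm D.Segment := Equiv.sumCongr D.next (Equiv.refl _)

/-- The component on which a segment lies. -/
def segmentComp : D.Segment → Fin μ := Sum.elim D.comp Subtype.val

theorem comp_next (p : D.Crossing × Level) : D.comp (D.next p) = D.comp p :=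
  (D.comp_eq_iff _ _).2 (Equiv.Perm.sameCycle_apply_left.2 (.refl _ _))

theorem segmentComp_nextSegment (s : D.Segment) :
    D.segmentComp (D.nextSegment s) = D.segmentComp s := by
  rcases s with p | i
  exacts [D.comp_next p, rfl]

theorem segmentComp_surjective : Function.Surjective D.segmentComp := fun i => by
  by_cases h : ∃ p, D.comp p = i
  · obtain ⟨p, hp⟩ := h
    exact ⟨.inl p, hp⟩
  · exact ⟨.inr ⟨i, not_exists.1 h⟩, rfl⟩

/-- A chosen segment of a component. -/
noncomputable def baseSegment (i : Fin μ) : D.Segment := (D.segmentComp_surjective i).choose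

theorem segmentComp_baseSegment (i : Fin μ) : D.segmentComp (D.baseSegment i) = i :=
  (D.segmentComp_surjective i).choose_spec

theorem nextSegment_pow_inl (n : ℕ) (p : D.Crossing × Level) :
    (D.nextSegment ^ n) (.inl p) = .inl ((D.next ^ n) p) := by
  induction n with
  | zero => rfl
  | succ n ih =>
    rw [pow_succ', pow_succ', Equiv.Perm.mul_apply, Equiv.Perm.mul_apply, ih]
    rfl

theorem exists_nextSegment_pow {s s' : D.Segment} (h : D.segmentComp s = D.segmentComp s') :
    ∃ n : ℕ, (D.nextSegment ^ n) s = s' := by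
  have := D.finite_crossing
  rcases s with p | i <;> rcases s' with q | j
  · obtain ⟨n, hn⟩ := ((D.comp_eq_iff p q).1 h).exists_nat_pow_eq
    exact ⟨n, by rw [nextSegment_pow_inl, hn]⟩
  · exact absurd h (j.2 p)
  · exact absurd h.symm (i.2 q)
  · exact ⟨0, congrArg Sum.inr (Subtype.ext h)⟩

/-- The arc that contains a segment. -/
def segmentArc (s : D.Segment) : D.Arc := Quot.mk _ s

instance : Finite D.Arc :=
  have := D.finite_crossing
  Finite.of_surjective D.segmentArc Quot.mk_surjective

/-- A chosen arc of a component. -/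
noncomputable def baseArc (i : Fin μ) : D.Arc := D.segmentArc (D.baseSegment i)

/-- Two consecutive segments lie on the same arc, or they are separated by an underpassage. -/
theorem nextSegment_cases (s : D.Segment) :
    (D.segmentArc (D.nextSegment s) = D.segmentArc s ∧
        ∀ c, D.nextSegment s ≠ .inl (c, .under)) ∨
      ∃ c, D.nextSegment s = .inl (c, .under) ∧ D.segmentArc s = D.inArc c := by
  rcases s with p | i
  · rcases hp : D.next p with ⟨c, l⟩
    have hs : D.nextSegment (.inl p) = .inl (c, l) := congrArg Sum.inl hp
    cases l
    · refine .inl ⟨?_, fun c' h => by simp [hs] at h⟩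
      rw [hs, ← hp]
      exact (Quot.sound (.over p (by rw [hp]))).symm
    · exact .inr ⟨c, hs, by rw [inArc, ← hp, Equiv.symm_apply_apply]; rfl⟩
  · exact .inl ⟨rfl, fun c h => by simp [nextSegment] at h⟩

/-- A property of arcs that passes through underpasses depends on the component only. -/
theorem segmentArc_induction {P : D.Arc → Prop} (hP : ∀ c, P (D.inArc c) → P (D.outArc c))
    {s s' : D.Segment} (h : D.segmentComp s = D.segmentComp s') (hs : P (D.segmentArc s)) :
    P (D.segmentArc s') := by
  obtain ⟨n, rfl⟩ := D.exists_nextSegment_pow h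
  clear h
  induction n with
  | zero => exact hs
  | succ n ih =>
    rw [pow_succ', Equiv.Perm.mul_apply]
    rcases D.nextSegment_cases ((D.nextSegment ^ n) s) with ⟨h, -⟩ | ⟨c, h, h'⟩
    · rwa [h]
    · rw [h]
      exact hP c (h' ▸ ih)

/-! ### The Alexander module at `t = -1` -/

/-- The class of an arc in the Alexander module. -/
noncomputable def arcClass (x : D.Arc) : D.AlexanderModule :=
  Submodule.Quotient.mk (Finsupp.single x 1)

theorem phi_arcClass (x : D.Arc) : D.phi (D.arcClass x) = 1 := by
  simp [phi, arcClass, Submodule.liftQ_apply]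

theorem arcClass_relation (c : D.Crossing) :
    (1 - LaurentPolynomial.T 1 : ℤ[T;T⁻¹]) • D.arcClass (D.overArc c)
      + (LaurentPolynomial.T 1 : ℤ[T;T⁻¹]) • D.arcClass (D.rightArc c)
      - D.arcClass (D.leftArc c) = 0 := by
  simp only [arcClass, ← Submodule.Quotient.mk_smul, ← Submodule.Quotient.mk_add,
    ← Submodule.Quotient.mk_sub, Submodule.Quotient.mk_eq_zero, Finsupp.smul_single,
    smul_eq_mul, mul_one]
  exact ⟨Finsupp.single c 1, by simp [rho]⟩

/-- A relation between the three arcs at a crossing that is symmetric in the two underpassing arcs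
may be stated for `inArc` and `outArc`. -/
theorem inArc_outArc_of_symm {P : D.Arc → D.Arc → D.Arc → Prop}
    (hP : ∀ x y z, P x y z → P x z y) (c : D.Crossing)
    (h : P (D.overArc c) (D.rightArc c) (D.leftArc c)) :
    P (D.overArc c) (D.inArc c) (D.outArc c) := by
  unfold rightArc leftArc at h
  split_ifs at h
  exacts [h, hP _ _ _ h]

theorem rightArc_leftArc_of_symm {P : D.Arc → D.Arc → D.Arc → Prop}
    (hP : ∀ x y z, P x y z → P x z y) (c : D.Crossing)
    (h : P (D.overArc c) (D.inArc c) (D.outArc c)) :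
    P (D.overArc c) (D.rightArc c) (D.leftArc c) := by
  unfold rightArc leftArc
  split_ifs
  exacts [h, hP _ _ _ h]

section

variable (a₀ : D.Arc)

/-- The difference of an arc and the reference arc `a₀`, in the kernel of `phi`. -/
noncomputable def kerClass (x : D.Arc) : LinearMap.ker D.phi :=
  ⟨D.arcClass x - D.arcClass a₀, by
    rw [LinearMap.mem_ker, map_sub, phi_arcClass, phi_arcClass, sub_self]⟩

/-- The projection from the kernel of `phi` to the Alexander invariant at `t = -1`. -/
noncomputable def kerProj :
    LinearMap.ker D.phi →ₗ[ℤ[T;T⁻¹]] D.AlexanderInvariantQuotient := Submodule.mkQ _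

theorem kerProj_surjective : Function.Surjective D.kerProj := Submodule.mkQ_surjective _

/-- The difference of an arc and the reference arc `a₀`, in the Alexander invariant at `t = -1`. -/
noncomputable def pos (x : D.Arc) : D.AlexanderInvariantQuotient := D.kerProj (D.kerClass a₀ x)

theorem pos_self : D.pos a₀ a₀ = 0 := by
  have : D.kerClass a₀ a₀ = 0 := Subtype.ext (sub_self _)
  rw [pos, this, map_zero]

open scoped Pointwise in
theorem T_smul (k : D.AlexanderInvariantQuotient) :
    (LaurentPolynomial.T 1 : ℤ[T;T⁻¹]) • k = -k := by
  obtain ⟨x, rfl⟩ := Submodule.Quotient.mk_surjective _ k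
  rw [← Submodule.Quotient.mk_smul, ← Submodule.Quotient.mk_neg, Submodule.Quotient.eq,
    sub_neg_eq_add]
  have := Submodule.smul_mem_pointwise_smul x (1 + LaurentPolynomial.T 1 : ℤ[T;T⁻¹])
    (⊤ : Submodule ℤ[T;T⁻¹] (LinearMap.ker D.phi)) trivial
  rwa [add_smul, one_smul, add_comm x] at this

theorem T_neg_smul (k : D.AlexanderInvariantQuotient) :
    (LaurentPolynomial.T (-1) : ℤ[T;T⁻¹]) • k = -k := by
  have h := D.T_smul ((LaurentPolynomial.T (-1) : ℤ[T;T⁻¹]) • k)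
  rw [smul_smul, ← LaurentPolynomial.T_add, add_neg_cancel, LaurentPolynomial.T_zero,
    one_smul] at h
  rw [h, neg_neg, ← h]

/-- The coefficients `1 - t`, `t`, `-1` of the crossing relation sum to zero, so it survives
replacing arcs by differences from `a₀`. Then put `t = -1`. -/
theorem pos_rightArc_add_pos_leftArc (c : D.Crossing) :
    D.pos a₀ (D.rightArc c) + D.pos a₀ (D.leftArc c)
      = D.pos a₀ (D.overArc c) + D.pos a₀ (D.overArc c) := by
  have h : (1 - LaurentPolynomial.T 1 : ℤ[T;T⁻¹]) • D.kerClass a₀ (D.overArc c)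
      + (LaurentPolynomial.T 1 : ℤ[T;T⁻¹]) • D.kerClass a₀ (D.rightArc c)
      - D.kerClass a₀ (D.leftArc c) = 0 := by
    refine Subtype.ext (Eq.trans ?_ (D.arcClass_relation c))
    simp only [kerClass, Submodule.coe_sub, Submodule.coe_add, Submodule.coe_smul]
    module
  have h' := congrArg D.kerProj h
  simp only [map_add, map_sub, map_smul, map_zero, sub_smul, one_smul, T_smul] at h'
  rw [← sub_eq_zero, ← neg_eq_zero, ← h', pos, pos, pos]
  abel

theorem pos_inArc_add_pos_outArc (c : D.Crossing) :
    D.pos a₀ (D.inArc c) + D.pos a₀ (D.outArc c)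
      = D.pos a₀ (D.overArc c) + D.pos a₀ (D.overArc c) :=
  D.inArc_outArc_of_symm (P := fun x y z => D.pos a₀ y + D.pos a₀ z = D.pos a₀ x + D.pos a₀ x)
    (fun _ _ _ h => (add_comm _ _).trans h) c (D.pos_rightArc_add_pos_leftArc a₀ c)

/-- As `t` acts by `-1`, scalars act through integers. -/
theorem smul_mem_addSubgroup (S : AddSubgroup D.AlexanderInvariantQuotient) (r : ℤ[T;T⁻¹])
    {k : D.AlexanderInvariantQuotient} (hk : k ∈ S) : r • k ∈ S := by
  induction r using LaurentPolynomial.induction_on with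
  | h_C a =>
    have : (LaurentPolynomial.C a : ℤ[T;T⁻¹]) = (a : ℤ[T;T⁻¹]) := by simp
    rw [this, Int.cast_smul_eq_zsmul]
    exact S.zsmul_mem hk a
  | h_add hp hq =>
    rw [add_smul]
    exact S.add_mem hp hq
  | h_C_mul_T n a h =>
    rw [LaurentPolynomial.T_add, ← mul_assoc, mul_comm, mul_smul, T_smul]
    exact S.neg_mem h
  | h_C_mul_T_Z n a h =>
    rw [sub_eq_add_neg, LaurentPolynomial.T_add, ← mul_assoc, mul_comm, mul_smul, T_neg_smul]
    exact S.neg_mem h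

/-- A combination of arcs in the kernel has coefficient sum zero, so subtracting `a₀` from each arc
does not change it. -/
theorem closure_range_pos : AddSubgroup.closure (Set.range (D.pos a₀)) = ⊤ := by
  rw [eq_top_iff]
  rintro k -
  obtain ⟨⟨m, hm⟩, rfl⟩ := D.kerProj_surjective k
  obtain ⟨f, rfl⟩ := Submodule.Quotient.mk_surjective _ m
  have hf : f.sum (fun _ r => r) = 0 := by
    simpa [phi, Submodule.liftQ_apply, Finsupp.linearCombination_apply] using hm
  have h : (⟨Submodule.Quotient.mk f, hm⟩ : LinearMap.ker D.phi)
      = ∑ x ∈ f.support, f x • D.kerClass a₀ x := by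
    ext1
    have h₁ : (Submodule.Quotient.mk f : D.AlexanderModule)
        = ∑ x ∈ f.support, f x • D.arcClass x := by
      conv_lhs => rw [← f.sum_single]
      simp only [Finsupp.sum, arcClass, ← Submodule.Quotient.mk_smul, Finsupp.smul_single,
        smul_eq_mul, mul_one]
      exact map_sum (Submodule.mkQ _) _ _
    have h₂ : (∑ x ∈ f.support, f x) = 0 := hf
    simp only [AddSubmonoidClass.coe_finsetSum, Submodule.coe_smul, kerClass, smul_sub,
      Finset.sum_sub_distrib, ← Finset.sum_smul, h₂, zero_smul, sub_zero, h₁]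
  rw [h, map_sum]
  refine sum_mem fun x _ => ?_
  rw [map_smul]
  exact D.smul_mem_addSubgroup _ _ (AddSubgroup.subset_closure ⟨x, rfl⟩)

/-- The universal property of the Alexander invariant at `t = -1`. -/
theorem exists_addMonoidHom_pos {G : Type} [AddCommGroup G] (f : D.Arc → G)
    (hf : ∀ c, f (D.rightArc c) + f (D.leftArc c) = f (D.overArc c) + f (D.overArc c)) :
    ∃ ψ : D.AlexanderInvariantQuotient →+ G, ∀ x, ψ (D.pos a₀ x) = f x - f a₀ := by
  -- Through `t ↦ -1` the group `G` becomes a `Λ`-module on which `1 + t` vanishes.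
  let ε : ℤ[T;T⁻¹] →+* ℤ := LaurentPolynomial.eval₂ (RingHom.id ℤ) (-1 : ℤˣ)
  have hε : ε (LaurentPolynomial.T 1) = -1 := by simp [ε]
  let : Module ℤ[T;T⁻¹] G := Module.compHom G ε
  have hsmul : ∀ (r : ℤ[T;T⁻¹]) (g : G), r • g = ε r • g := fun _ _ => rfl
  have hT : ∀ g : G, (LaurentPolynomial.T 1 : ℤ[T;T⁻¹]) • g = -g := fun g => by
    rw [hsmul, hε, neg_smul, one_smul]
  let L : D.AlexanderModule →ₗ[ℤ[T;T⁻¹]] G :=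
    (LinearMap.range D.rho).liftQ (Finsupp.linearCombination ℤ[T;T⁻¹] f) <| by
      rw [LinearMap.range_le_ker_iff]
      ext c
      simp only [rho, LinearMap.comp_apply, Finsupp.lsingle_apply,
        Finsupp.linearCombination_single, one_smul, map_sub, map_add, LinearMap.zero_apply,
        sub_smul, hT]
      rw [sub_neg_eq_add, ← hf c]
      abel
  have hL : ∀ x, L (D.arcClass x) = f x := fun x => by
    simp [L, arcClass, Submodule.liftQ_apply]
  let ψ : D.AlexanderInvariantQuotient →ₗ[ℤ[T;T⁻¹]] G :=
    Submodule.liftQ _ (L.comp (LinearMap.ker D.phi).subtype) <| by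
      intro x hx
      obtain ⟨y, -, rfl⟩ := hx
      change L (((1 + LaurentPolynomial.T 1 : ℤ[T;T⁻¹]) • y : LinearMap.ker D.phi) : _) = 0
      rw [Submodule.coe_smul, map_smul, add_smul, one_smul, hT, add_neg_cancel]
  refine ⟨ψ.toAddMonoidHom, fun x => ?_⟩
  change L (D.arcClass x - D.arcClass a₀) = _
  rw [map_sub, hL, hL]

end

end VirtualLinkDiagram

namespace VirtualLinkDiagram

variable {μ : ℕ} (D : VirtualLinkDiagram μ)

/-! ### The involutory medial quandle as a quotient of copies of the Alexander invariant -/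

theorem isInvolutoryMedial_IMQ : IsInvolutoryMedial D.IMQ :=
  InvolutoryQuotient.isInvolutoryMedial PresentedMedialQuandle.medial

/-- The generators of the involutory medial quandle. -/
def gen (x : D.Arc) : D.IMQ := InvolutoryQuotient.of (PresentedQuandle.mk _ (.of x))

theorem gen_leftArc (c : D.Crossing) :
    D.gen (D.leftArc c) = D.gen (D.overArc c) ◃ D.gen (D.rightArc c) := by
  rw [gen, gen, gen, ← InvolutoryQuotient.of_act, ← PresentedQuandle.mk_act]
  exact congrArg _ (PresentedQuandle.mk_eq (.rel (.crossing c)))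

/-- Involutivity makes the crossing relation symmetric in the underpassing arcs, so the writhe no
longer matters. -/
theorem gen_outArc (c : D.Crossing) :
    D.gen (D.outArc c) = D.gen (D.overArc c) ◃ D.gen (D.inArc c) :=
  D.inArc_outArc_of_symm (P := fun x y z => D.gen z = D.gen x ◃ D.gen y)
    (fun x y z h => by rw [h, D.isInvolutoryMedial_IMQ.invol]) c (D.gen_leftArc c)

theorem IMQ_induction {P : D.IMQ → Prop} (hgen : ∀ x, P (D.gen x))
    (hact : ∀ x z, P z → P (D.gen x ◃ z)) (z : D.IMQ) : P z := by
  have hQ := D.isInvolutoryMedial_IMQ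
  obtain ⟨m, rfl⟩ := InvolutoryQuotient.of_surjective z
  obtain ⟨w, rfl⟩ := PresentedQuandle.mk_surjective m
  -- Strengthened so that words also preserve `P` as translations; this is inherited because `β_{y ◃
  -- x} = β_y β_x β_y`.
  suffices h : P (.of (.mk _ w)) ∧ ∀ z, P z → P (.of (.mk _ w) ◃ z) from h.1
  have key : ∀ y x : D.IMQ, (P y ∧ ∀ z, P z → P (y ◃ z)) → (P x ∧ ∀ z, P z → P (x ◃ z)) →
      P (y ◃ x) ∧ ∀ z, P z → P ((y ◃ x) ◃ z) := fun y x hy hx =>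
    ⟨hy.2 _ hx.1, fun z hz => by
      have : (y ◃ x) ◃ z = y ◃ x ◃ y ◃ z := by
        conv_lhs => rw [← hQ.invol z y]
        rw [← Shelf.self_distrib]
      rw [this]
      exact hy.2 _ (hx.2 _ (hy.2 _ hz))⟩
  induction w with
  | of x => exact ⟨hgen x, hact x⟩
  | act y x ihy ihx =>
    rw [PresentedQuandle.mk_act, InvolutoryQuotient.of_act]
    exact key _ _ ihy ihx
  | invAct y x ihy ihx =>
    rw [PresentedQuandle.mk_invAct, InvolutoryQuotient.of_invAct, hQ.invAct_eq]
    exact key _ _ ihy ihx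

theorem isEmpty_IMQ [IsEmpty (Fin μ)] : IsEmpty D.IMQ :=
  ⟨fun z => D.IMQ_induction (P := fun _ => False)
    (fun x => by
      obtain ⟨s, -⟩ := Quot.exists_rep x
      exact isEmptyElim (D.segmentComp s)) (fun _ _ h => h) z⟩

/-- The Alexander invariant at `t = -1` acts on the involutory medial quandle by displacements. -/
theorem exists_displacement (a₀ : D.Arc) :
    ∃ g : Multiplicative D.AlexanderInvariantQuotient →* Equiv.Perm D.IMQ,
      (∀ x, g (.ofAdd (D.pos a₀ x)) = Rack.act' (D.gen x) * Rack.act' (D.gen a₀)) ∧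
      ∀ k, Rack.act' (D.gen a₀) * g k * Rack.act' (D.gen a₀) = (g k)⁻¹ := by
  have hQ := D.isInvolutoryMedial_IMQ
  set β : D.Arc → Equiv.Perm D.IMQ := fun x => Rack.act' (D.gen x) with hβ
  have hβ2 : ∀ x, β x * β x = 1 := fun x => hQ.act'_mul_self _
  have hβ2' : ∀ x g, β x * (β x * g) = g := fun x g => by rw [← mul_assoc, hβ2, one_mul]
  let S : Set (Equiv.Perm D.IMQ) := Set.range fun x => β x * β a₀
  have hS : ∀ g ∈ S, ∀ h ∈ S, g * h = h * g := by
    rintro _ ⟨x, rfl⟩ _ ⟨y, rfl⟩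
    exact hQ.commute_act'_mul _ _ _
  have := Subgroup.isMulCommutative_closure hS
  let H := Subgroup.closure S
  let _ : CommGroup H := { (inferInstance : Group H) with mul_comm := this.is_comm.comm }
  let d : D.Arc → H := fun x => ⟨β x * β a₀, Subgroup.subset_closure ⟨x, rfl⟩⟩
  have hd₀ : d a₀ = 1 := Subtype.ext (hβ2 a₀)
  have hd : ∀ c, d (D.inArc c) * d (D.outArc c) = d (D.overArc c) * d (D.overArc c) := by
    intro c
    rw [mul_comm]
    have h : d (D.outArc c) = d (D.overArc c) * (d (D.inArc c))⁻¹ * d (D.overArc c) := by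
      refine Subtype.ext ?_
      have h₁ : β (D.outArc c) = β (D.overArc c) * β (D.inArc c) * β (D.overArc c) := by
        simp only [hβ, D.gen_outArc, hQ.act'_act]
      have h₂ : (β (D.inArc c) * β a₀)⁻¹ = β a₀ * β (D.inArc c) := by
        rw [mul_inv_rev, hQ.act'_inv, hQ.act'_inv]
      simp only [d, Subgroup.coe_mul, Subgroup.coe_inv, h₁, h₂, mul_assoc, hβ2']
    rw [h, mul_right_comm, inv_mul_cancel_right]
  obtain ⟨ψ, hψ⟩ := D.exists_addMonoidHom_pos a₀ (fun x => Additive.ofMul (d x))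
    (D.rightArc_leftArc_of_symm
      (P := fun x y z => Additive.ofMul (d y) + .ofMul (d z) = .ofMul (d x) + .ofMul (d x))
      (fun _ _ _ h => (add_comm _ _).trans h) · (congrArg Additive.ofMul (hd _)))
  refine ⟨H.subtype.comp (AddMonoidHom.toMultiplicativeLeft ψ), fun x => ?_, fun k => ?_⟩
  · change ((ψ (D.pos a₀ x)).toMul : Equiv.Perm D.IMQ) = _
    rw [hψ, hd₀, ofMul_one, sub_zero]
    rfl
  -- Conjugation by `β a₀` inverts each generator `β x * β a₀`; commutativity extends this to
  -- products.
  · have hk : ∀ g ∈ H, β a₀ * g * β a₀ = g⁻¹ := by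
      intro g hg
      induction hg using Subgroup.closure_induction with
      | mem g hg =>
        obtain ⟨x, rfl⟩ := hg
        rw [mul_inv_rev, hQ.act'_inv, hQ.act'_inv, mul_assoc, mul_assoc, hβ2, mul_one]
      | one => rw [mul_one, hβ2, inv_one]
      | mul g h hg hh ihg ihh =>
        have hc : g * h = h * g := congrArg Subtype.val (mul_comm (⟨g, hg⟩ : H) ⟨h, hh⟩)
        rw [hc, mul_inv_rev, ← ihg, ← ihh, ← hc]
        simp only [mul_assoc, hβ2']
      | inv g hg ih =>
        have h := congrArg Inv.inv ih
        rwa [mul_inv_rev, mul_inv_rev, hQ.act'_inv, ← mul_assoc] at h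
    exact hk _ (Subtype.prop _)

theorem exists_surjective_to_IMQ :
    ∃ F : Fin μ × D.AlexanderInvariantQuotient → D.IMQ, Function.Surjective F := by
  rcases isEmpty_or_nonempty (Fin μ) with h | ⟨⟨i₀⟩⟩
  · have := D.isEmpty_IMQ
    exact ⟨fun p => isEmptyElim p.1, fun z => isEmptyElim z⟩
  have hQ := D.isInvolutoryMedial_IMQ
  set a₀ := D.baseArc i₀
  obtain ⟨g, hg, hg₀⟩ := D.exists_displacement a₀
  -- Since `β_y` fixes `D.gen y`, it may be inserted on the right, and `β_x g_k β_y = (β_x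
  -- β_{a₀})(β_{a₀} g_k β_{a₀})(β_{a₀} β_y)` is a displacement. So translations by generators
  -- preserve each orbit.
  have hact : ∀ x y k, Rack.act' (D.gen x) (g k (D.gen y))
      = g (.ofAdd (D.pos a₀ x) * k⁻¹ * (.ofAdd (D.pos a₀ y))⁻¹) (D.gen y) := by
    intro x y k
    have hy : Rack.act' (D.gen y) (D.gen y) = D.gen y :=
      Quandle.fix (x := D.gen y)
    conv_lhs => rw [← hy]
    rw [map_mul, map_mul, map_inv, map_inv, ← hg₀, hg, hg, mul_inv_rev, hQ.act'_inv, hQ.act'_inv]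
    have h2 : ∀ z, Rack.act' (D.gen a₀) (Rack.act' (D.gen a₀) z) = z := fun z =>
      hQ.invol z (D.gen a₀)
    simp only [Equiv.Perm.mul_apply, h2]
  refine ⟨fun p => g (.ofAdd p.2) (D.gen (D.baseArc p.1)), fun z => ?_⟩
  suffices h : ∃ i k, g k (D.gen (D.baseArc i)) = z by
    obtain ⟨i, k, h⟩ := h
    exact ⟨(i, k.toAdd), h⟩
  refine D.IMQ_induction (P := fun z => ∃ i k, g k (D.gen (D.baseArc i)) = z) (fun x => ?_)
    (fun x z hz => ?_) z
  · obtain ⟨s, rfl⟩ : ∃ s, D.segmentArc s = x := Quot.exists_rep x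
    refine ⟨D.segmentComp s, ?_⟩
    refine D.segmentArc_induction
      (P := fun x => ∃ k, g k (D.gen (D.baseArc (D.segmentComp s))) = D.gen x)
      (fun c hc => ?_) (D.segmentComp_baseSegment (D.segmentComp s)) ⟨1, by rw [map_one]; rfl⟩
    obtain ⟨k, hk⟩ := hc
    rw [gen_outArc, ← hk]
    exact ⟨_, (hact _ _ _).symm⟩
  · obtain ⟨i, k, rfl⟩ := hz
    exact ⟨i, _, (hact _ _ _).symm⟩

end VirtualLinkDiagram

/-! ### A union of quotients of an abelian group as an involutory medial quandle -/

/-- The disjoint union of the quotients of an abelian group by the elements `h i`. -/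
abbrev QuotientMesh {I K : Type} [AddCommGroup K] (h : I → K) : Type :=
  Σ i, K ⧸ AddSubgroup.zmultiples (h i)

namespace QuotientMesh

variable {I K : Type} [AddCommGroup K] {h : I → K} (hh : ∀ i, h i + h i = 0) (e : I → K)

/-- The element `e i + 2 u`, which determines the translation of the element `u` of index `i`. -/
def label (y : QuotientMesh h) : K :=
  e y.1 + QuotientAddGroup.lift _ (AddMonoidHom.id K + AddMonoidHom.id K)
    ((AddSubgroup.zmultiples_le).2 (hh y.1)) y.2

theorem label_mk (i : I) (u : K) : label hh e ⟨i, u⟩ = e i + (u + u) := rfl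

/-- The translation of the element `u` of index `i` is `v ↦ e i + 2 u - e j - v` at the index
`j`. -/
def translate (y x : QuotientMesh h) : QuotientMesh h :=
  ⟨x.1, ((label hh e y - e x.1 : K) : K ⧸ AddSubgroup.zmultiples (h x.1)) - x.2⟩

theorem translate_translate (y x : QuotientMesh h) :
    translate hh e y (translate hh e y x) = x :=
  congrArg (Sigma.mk x.1) (sub_sub_cancel _ _)

/-- Translation by `y` reflects labels in the label of `y`: `e j + 2(l - e j - v) = 2l - (e j +
2v)`. The quandle axioms and mediality then reduce to abelian arithmetic. -/
theorem label_translate (y x : QuotientMesh h) :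
    label hh e (translate hh e y x) = label hh e y + label hh e y - label hh e x := by
  obtain ⟨j, v⟩ := x
  induction v using QuotientAddGroup.induction_on with | H v =>
  generalize hy : label hh e y = l
  rw [translate, hy]
  dsimp only
  rw [← QuotientAddGroup.mk_sub, label_mk, label_mk]
  abel

/-- The quandle structure on a `QuotientMesh`. -/
abbrev quandle : Quandle (QuotientMesh h) where
  act := translate hh e
  invAct := translate hh e
  left_inv := translate_translate hh e
  right_inv := translate_translate hh e
  self_distrib := by
    intro x y ⟨j, v⟩
    conv_rhs => rw [translate, label_translate]
    refine congrArg (Sigma.mk j) ?_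
    simp only [translate, QuotientAddGroup.mk_sub, QuotientAddGroup.mk_add]
    abel
  fix := by
    rintro ⟨j, v⟩
    induction v using QuotientAddGroup.induction_on with | H v =>
    rw [translate, label_mk]
    refine congrArg (Sigma.mk j) ?_
    dsimp only
    rw [← QuotientAddGroup.mk_sub]
    congr 1
    abel

theorem isInvolutoryMedial : letI := quandle hh e; IsInvolutoryMedial (QuotientMesh h) := by
  let := quandle hh e
  refine ⟨fun ⟨j, v⟩ x y z => ?_, fun x y => translate_translate hh e y x⟩
  change translate hh e (translate hh e z y) (translate hh e x ⟨j, v⟩)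
    = translate hh e (translate hh e z x) (translate hh e y ⟨j, v⟩)
  have key : ∀ a b : QuotientMesh h, translate hh e a (translate hh e b ⟨j, v⟩)
      = ⟨j, ((label hh e a - e j : K) : K ⧸ AddSubgroup.zmultiples (h j))
        - (((label hh e b - e j : K) : K ⧸ AddSubgroup.zmultiples (h j)) - v)⟩ := fun _ _ => rfl
  rw [key, key, label_translate, label_translate]
  refine congrArg (Sigma.mk j) ?_
  simp only [QuotientAddGroup.mk_sub, QuotientAddGroup.mk_add]
  abel

theorem translate_translate_mk (y y₀ : QuotientMesh h) (i : I)
    (u : K ⧸ AddSubgroup.zmultiples (h i)) :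
    translate hh e y (translate hh e y₀ ⟨i, u⟩)
      = ⟨i, ((label hh e y - label hh e y₀ : K) : K ⧸ AddSubgroup.zmultiples (h i)) + u⟩ := by
  refine congrArg (Sigma.mk i) ?_
  simp only [translate, QuotientAddGroup.mk_sub]
  abel

/-- A set that is closed under translations whose labels generate the group, and that contains the
zero elements, is everything. -/
theorem mem_of_translate_mem {J : Type} (y : J → QuotientMesh h) (j₀ : J)
    (hj₀ : label hh e (y j₀) = 0)
    (hy : AddSubgroup.closure (Set.range fun j => label hh e (y j)) = ⊤)
    {S : Set (QuotientMesh h)} (hS : ∀ j, ∀ x ∈ S, translate hh e (y j) x ∈ S)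
    (hS₀ : ∀ i, ⟨i, 0⟩ ∈ S) (x : QuotientMesh h) : x ∈ S := by
  -- Since `y j₀` has label zero, translating by `y j₀` and then `y j` shifts by the label of `y j`.
  -- The equivalence lets the induction pass to negatives.
  have hadd : ∀ k ∈ AddSubgroup.closure (Set.range fun j => label hh e (y j)), ∀ i u,
      (⟨i, u⟩ : QuotientMesh h) ∈ S ↔
        (⟨i, (k : K ⧸ AddSubgroup.zmultiples (h i)) + u⟩ : QuotientMesh h) ∈ S := by
    intro k hk
    induction hk using AddSubgroup.closure_induction with
    | mem k hk =>
      obtain ⟨j, rfl⟩ := hk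
      intro i u
      constructor
      · intro hu
        have := hS j _ (hS j₀ _ hu)
        rwa [translate_translate_mk, hj₀, sub_zero] at this
      · intro hu
        have := hS j₀ _ (hS j _ hu)
        rwa [translate_translate_mk, hj₀, zero_sub, QuotientAddGroup.mk_neg,
          neg_add_cancel_left] at this
    | zero =>
      intro i u
      rw [QuotientAddGroup.mk_zero, zero_add]
    | add k l _ _ ihk ihl =>
      intro i u
      rw [ihl, ihk, QuotientAddGroup.mk_add, add_assoc]
    | neg k _ ih =>
      intro i u
      rw [ih i (_ + u), QuotientAddGroup.mk_neg, add_neg_cancel_left]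
  obtain ⟨i, u⟩ := x
  induction u using QuotientAddGroup.induction_on with | H u =>
  have := (hadd u (by rw [hy]; trivial) i 0).1 (hS₀ i)
  rwa [add_zero] at this

end QuotientMesh

theorem Nat.card_le_card_quotient_zmultiples_mul_two {K : Type*} [AddCommGroup K] {h : K}
    (hh : h + h = 0) : Nat.card K ≤ Nat.card (K ⧸ AddSubgroup.zmultiples h) * 2 := by
  rw [AddSubgroup.card_eq_card_quotient_mul_card_addSubgroup (AddSubgroup.zmultiples h),
    Nat.card_zmultiples]
  exact Nat.mul_le_mul_left _
    (Nat.le_of_dvd two_pos (addOrderOf_dvd_iff_nsmul_eq_zero.2 (by rwa [two_nsmul])))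

/-! ### Colourings of the arcs by the mesh, and absence of 2-torsion for knots -/

namespace VirtualLinkDiagram

variable {μ : ℕ} (D : VirtualLinkDiagram μ)

/-- The homomorphism from `IMQ(L)` to an involutory medial quandle that is given by a colouring of
the arcs. -/
theorem exists_shelfHom_IMQ {Q : Type} [Quandle Q] (hQ : IsInvolutoryMedial Q) (f : D.Arc → Q)
    (hf : ∀ c, f (D.outArc c) = f (D.overArc c) ◃ f (D.inArc c)) :
    ∃ F : D.IMQ →◃ Q, ∀ x, F.toFun (D.gen x) = f x := by
  have hf' : ∀ c, f (D.leftArc c) = f (D.overArc c) ◃ f (D.rightArc c) := fun c =>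
    D.rightArc_leftArc_of_symm (P := fun x y z => f z = f x ◃ f y)
      (fun x y z h => by rw [h, hQ.invol]) c (hf c)
  let F₁ : D.MQ →◃ Q := PresentedQuandle.lift f <| by
    rintro _ _ (⟨⟨c⟩⟩ | ⟨w, x, y, z⟩)
    exacts [hf' c, hQ.medial _ _ _ _]
  exact ⟨PresentedQuandle.lift F₁.toFun (by
    rintro _ _ (⟨x, y⟩ | ⟨x, y⟩)
    · exact F₁.map_act'.symm
    · simp only [QuandleWord.eval, F₁.map_act', hQ.invol]), fun x => rfl⟩

/-- The arcs can be halved consistently along each component, up to an element of order two. -/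
theorem exists_halves (a₀ : D.Arc) (i : Fin μ) :
    ∃ (h : D.AlexanderInvariantQuotient) (v : D.Segment → D.AlexanderInvariantQuotient),
      h + h = 0 ∧ v (D.baseSegment i) = 0 ∧ ∀ s, D.segmentComp s = i →
        D.pos a₀ (D.baseArc i) + (v s + v s) = D.pos a₀ (D.segmentArc s) ∧
        ((∀ c, D.nextSegment s ≠ .inl (c, .under)) →
          (v (D.nextSegment s) : D.AlexanderInvariantQuotient ⧸ AddSubgroup.zmultiples h) = v s) ∧
        ∀ c, D.nextSegment s = .inl (c, .under) →
          (v (D.nextSegment s) : D.AlexanderInvariantQuotient ⧸ AddSubgroup.zmultiples h)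
            = ((D.pos a₀ (D.overArc c) - D.pos a₀ (D.baseArc i) - v s :
              D.AlexanderInvariantQuotient) : _ ⧸ AddSubgroup.zmultiples h) := by
  set e := D.pos a₀ (D.baseArc i)
  -- At an underpassage this is the mesh translation by a colour with label `pos (overArc c)`.
  let step : D.Segment → D.AlexanderInvariantQuotient → D.AlexanderInvariantQuotient :=
    fun s z => match s with
      | .inl (c, .under) => D.pos a₀ (D.overArc c) - e - z
      | _ => z
  have hstep : ∀ s z, (∀ c, s ≠ .inl (c, .under)) → step s z = z := by
    rintro (⟨c, _ | _⟩ | j) z hs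
    exacts [rfl, absurd rfl (hs c), rfl]
  let P : D.Segment → D.AlexanderInvariantQuotient → Prop :=
    fun s z => e + (z + z) = D.pos a₀ (D.segmentArc s)
  have hP : ∀ s z, P s z → P (D.nextSegment s) (step (D.nextSegment s) z) := by
    intro s z hz
    rcases D.nextSegment_cases s with ⟨h, h'⟩ | ⟨c, h, h'⟩
    · rw [hstep _ _ h']
      exact hz.trans (congrArg _ h.symm)
    · rw [h]
      change e + ((D.pos a₀ (D.overArc c) - e - z) + (D.pos a₀ (D.overArc c) - e - z))
        = D.pos a₀ (D.outArc c)
      have h₁ := D.pos_inArc_add_pos_outArc a₀ c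
      rw [← h', ← (show _ = _ from hz)] at h₁
      rw [eq_sub_of_add_eq' h₁]
      abel
  obtain ⟨v, hv₀, hv⟩ := D.nextSegment.exists_propagate step (D.baseSegment i) 0 P
    (by simp only [P, add_zero]; rfl) hP
  have hreach : ∀ s, D.segmentComp s = i → ∃ n : ℕ, (D.nextSegment ^ n) (D.baseSegment i) = s :=
    fun s hs => D.exists_nextSegment_pow ((D.segmentComp_baseSegment i).trans hs.symm)
  let s₁ := D.nextSegment.symm (D.baseSegment i)
  have hs₁ : D.nextSegment s₁ = D.baseSegment i := Equiv.apply_symm_apply _ _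
  have hs₁' : D.segmentComp s₁ = i := by
    rw [← D.segmentComp_nextSegment, hs₁, D.segmentComp_baseSegment]
  -- The value found on returning to the base segment. Both `h` and the initial value `0` satisfy
  -- `P` there, so `h + h = 0`.
  let h := step (D.baseSegment i) (v s₁)
  have hh : P (D.baseSegment i) h := by
    have := hP _ _ (hv s₁ (hreach s₁ hs₁')).1
    rwa [hs₁] at this
  have hnext : ∀ s, D.segmentComp s = i →
      (v (D.nextSegment s) : D.AlexanderInvariantQuotient ⧸ AddSubgroup.zmultiples h)
        = (step (D.nextSegment s) (v s) : D.AlexanderInvariantQuotient) := by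
    intro s hs
    by_cases hb : D.nextSegment s = D.baseSegment i
    · have : s = s₁ := (Equiv.eq_symm_apply _).2 hb
      rw [hb, hv₀, this, QuotientAddGroup.eq, neg_zero, zero_add]
      exact AddSubgroup.mem_zmultiples h
    · rw [(hv s (hreach s hs)).2 hb]
  refine ⟨h, v, add_eq_left.1 hh, hv₀, fun s hs => ⟨(hv s (hreach s hs)).1, fun hc => ?_,
    fun c hc => ?_⟩⟩
  · rw [hnext s hs, hstep _ _ hc]
  · rw [hnext s hs, hc]

/-- The colour of an arc `x` has label `pos x`. These labels include `0` and generate the group, and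
base arcs have the zero colours, so `mem_of_translate_mem` applies to the image. -/
theorem exists_surjective_from_IMQ (a₀ : D.Arc) :
    ∃ h : Fin μ → D.AlexanderInvariantQuotient, (∀ i, h i + h i = 0) ∧
      ∃ F : D.IMQ → QuotientMesh h, Function.Surjective F := by
  choose h v hh hv₀ hv using D.exists_halves a₀
  refine ⟨h, hh, ?_⟩
  let e : Fin μ → D.AlexanderInvariantQuotient := fun i => D.pos a₀ (D.baseArc i)
  let := QuotientMesh.quandle hh e
  have hQ : IsInvolutoryMedial (QuotientMesh h) := QuotientMesh.isInvolutoryMedial hh e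
  let col : Fin μ → D.Segment → QuotientMesh h := fun i s => ⟨i, v i s⟩
  have hcol : ∀ i s, D.segmentComp s = i →
      QuotientMesh.label hh e (col i s) = D.pos a₀ (D.segmentArc s) :=
    fun i s hs => (hv i s hs).1
  let f : D.Arc → QuotientMesh h := Quot.lift (fun s => col (D.segmentComp s) s) <| by
    rintro _ _ ⟨p, hp⟩
    have h₁ : D.segmentComp (.inl (D.next p)) = D.segmentComp (.inl p) := D.comp_next p
    rw [h₁]
    refine congrArg (Sigma.mk _) ((hv _ (.inl p) rfl).2.1 fun c hc => ?_).symm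
    rw [Sum.inl.inj hc] at hp
    cases hp
  have hf : ∀ s, f (D.segmentArc s) = col (D.segmentComp s) s := fun _ => rfl
  have hlabel : ∀ x, QuotientMesh.label hh e (f x) = D.pos a₀ x :=
    fun x => by
      obtain ⟨s, rfl⟩ : ∃ s, D.segmentArc s = x := Quot.exists_rep x
      exact hcol _ s rfl
  obtain ⟨F, hF⟩ := D.exists_shelfHom_IMQ hQ f <| by
    intro c
    let s : D.Segment := .inl (D.next.symm (c, .under))
    have hs : D.nextSegment s = .inl (c, .under) :=
      congrArg Sum.inl (Equiv.apply_symm_apply _ _)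
    have h₁ : D.segmentComp (.inl (c, .under)) = D.segmentComp s := by
      rw [← hs, D.segmentComp_nextSegment]
    change col (D.segmentComp (.inl (c, .under))) (.inl (c, .under))
      = QuotientMesh.translate hh e (f (D.overArc c)) (col (D.segmentComp s) s)
    rw [h₁, QuotientMesh.translate, hlabel]
    refine congrArg (Sigma.mk _) ?_
    have := (hv _ s rfl).2.2 c hs
    rw [hs] at this
    exact this
  refine ⟨F.toFun, QuotientMesh.mem_of_translate_mem hh e f a₀ ?_ ?_ ?_ fun i => ?_⟩
  · rw [hlabel, pos_self]
  · simp only [hlabel, closure_range_pos]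
  · rintro x _ ⟨z, rfl⟩
    refine ⟨D.gen x ◃ z, ?_⟩
    rw [F.map_act', hF]
    rfl
  · refine ⟨D.gen (D.baseArc i), ?_⟩
    rw [hF, baseArc, hf, segmentComp_baseSegment]
    exact congrArg (fun k : D.AlexanderInvariantQuotient => (⟨i, k⟩ : QuotientMesh h)) (hv₀ i)

/-- For a knot, the Alexander invariant at `t = -1` has no element of order two. -/
theorem eq_zero_of_add_self (a₀ : D.Arc) (hμ : Subsingleton (Fin μ))
    {h : D.AlexanderInvariantQuotient} (hh : h + h = 0) : h = 0 := by
  let φ : D.AlexanderInvariantQuotient →ₗ[ℤ] D.AlexanderInvariantQuotient :=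
    LinearMap.id + LinearMap.id
  have hφ : ∀ k, φ k = k + k := fun _ => rfl
  -- The single component is walked from `a₀`, where `pos` is `0`; if `pos` of the incoming arc is
  -- `2k`, that of the outgoing arc is `2(pos (overArc c) - k)`.
  have hpos : ∀ x, ∃ k, k + k = D.pos a₀ x := by
    intro x
    obtain ⟨s₀, rfl⟩ : ∃ s, D.segmentArc s = a₀ := Quot.exists_rep a₀
    obtain ⟨s, rfl⟩ : ∃ s, D.segmentArc s = x := Quot.exists_rep x
    refine D.segmentArc_induction (P := fun x => ∃ k, k + k = D.pos (D.segmentArc s₀) x) (fun c hc => ?_)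
      (Subsingleton.elim (D.segmentComp s₀) _) ⟨0, by rw [pos_self, add_zero]⟩
    obtain ⟨k, hk⟩ := hc
    refine ⟨D.pos (D.segmentArc s₀) (D.overArc c) - k, ?_⟩
    have := D.pos_inArc_add_pos_outArc (D.segmentArc s₀) c
    rw [← hk, ← eq_sub_iff_add_eq'] at this
    rw [this]
    abel
  have hsurj : Function.Surjective φ := by
    intro k
    have hk : k ∈ AddSubgroup.closure (Set.range (D.pos a₀)) := by
      rw [closure_range_pos]
      trivial
    induction hk using AddSubgroup.closure_induction with
    | mem k hk =>
      obtain ⟨x, rfl⟩ := hk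
      exact hpos x
    | zero => exact ⟨0, map_zero φ⟩
    | add k l _ _ ihk ihl =>
      obtain ⟨k', rfl⟩ := ihk
      obtain ⟨l', rfl⟩ := ihl
      exact ⟨k' + l', map_add φ _ _⟩
    | neg k _ ih =>
      obtain ⟨k', rfl⟩ := ih
      exact ⟨-k', map_neg φ _⟩
  have : Module.Finite ℤ D.AlexanderInvariantQuotient := by
    rw [Module.Finite.iff_addGroup_fg, AddGroup.fg_iff]
    exact ⟨_, D.closure_range_pos a₀, Set.finite_range _⟩
  have hinj := IsNoetherian.injective_of_surjective_endomorphism φ hsurj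
  exact hinj (by rw [hφ, hh, map_zero])

end VirtualLinkDiagram

theorem mainTheorem7 (μ : ℕ) (D : VirtualLinkDiagram μ) :
    (Finite D.AlexanderInvariantQuotient →
      Finite D.IMQ ∧
      (μ * Nat.card D.AlexanderInvariantQuotient : ℚ) / 2 ≤ Nat.card D.IMQ ∧
      Nat.card D.IMQ ≤ μ * Nat.card D.AlexanderInvariantQuotient) ∧
    (μ = 1 → Cardinal.mk D.IMQ = Cardinal.mk D.AlexanderInvariantQuotient) := by
  obtain ⟨F, hF⟩ := D.exists_surjective_to_IMQ
  refine ⟨fun hK => ?_, ?_⟩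
  · have hfin : Finite D.IMQ := Finite.of_surjective F hF
    refine ⟨hfin, ?_, ?_⟩
    · rcases isEmpty_or_nonempty (Fin μ) with hμ | ⟨⟨i₀⟩⟩
      · have : μ = 0 := Nat.eq_zero_of_not_pos fun h => hμ.false ⟨0, h⟩
        simp [this]
      obtain ⟨h, hh, G, hG⟩ := D.exists_surjective_from_IMQ (D.baseArc i₀)
      have h₁ := Nat.card_le_card_of_surjective G hG
      have h₂ : μ * Nat.card D.AlexanderInvariantQuotient ≤ Nat.card (QuotientMesh h) * 2 := by
        rw [Nat.card_sigma, Finset.sum_mul]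
        simpa using Finset.card_nsmul_le_sum Finset.univ _ _ fun i _ =>
          Nat.card_le_card_quotient_zmultiples_mul_two (hh i)
      rw [div_le_iff₀ two_pos]
      exact_mod_cast h₂.trans (Nat.mul_le_mul_right 2 h₁)
    · simpa using Nat.card_le_card_of_surjective F hF
  · rintro rfl
    -- Comparing cardinals in both directions needs no finiteness; as `h 0 = 0`, the mesh is the
    -- group itself.
    refine le_antisymm ?_ ?_
    · refine (Cardinal.mk_le_of_surjective hF).trans (Cardinal.mk_congr ?_).le
      exact Equiv.uniqueProd _ _
    · obtain ⟨h, hh, G, hG⟩ := D.exists_surjective_from_IMQ (D.baseArc 0)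
      refine (Cardinal.mk_congr ?_).le.trans (Cardinal.mk_le_of_surjective hG)
      have h₀ : AddSubgroup.zmultiples (h 0) = ⊥ := by
        rw [D.eq_zero_of_add_self (D.baseArc 0) inferInstance (hh 0),
          AddSubgroup.zmultiples_zero_eq_bot]
      exact ((Equiv.uniqueSigma _).trans
        ((QuotientAddGroup.quotientAddEquivOfEq h₀).trans
          QuotientAddGroup.quotientBot).toEquiv).symm
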